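/- All trees are finite, rooted and ordered, with vertices labelled from an arbitrary alphabet. For a graph $G$ let $n_G$ be its number of vertices plus its number of edges. The minimal DAG of a tree has one vertex for each distinct rooted subtree (a vertex with all its descendants, up to equality of structure and labels), and from the vertex of a subtree $S$ one edge for each child of the root of $S$, in order and counted with multiplicity, to the vertex of the subtree rooted at that child. The top tree $\mathcal T$ of a tree $T$ is the ordered binary labelled tree built greedily as follows. Start with $\tilde T=T$; each edge of $T$ is a leaf of $\mathcal T$, labelled with the pair (label of the parent, label of the child). Merging two edges of $\tilde T$ creates a node of $\mathcal T$ whose left and right child are the nodes of $\mathcal T$ that stand for the two edges (upper edge first, or left edge first), labelled with one of five merge types. A vertical merge contracts an edge $(u,v)$ and the edge $(v,w)$ from $v$ to its parent $w$, where $u$ is the only child of $v$, into one edge; its type is (a) or (b) according as $u$ is not or is a leaf of $\tilde T$. A horizontal merge replaces two neighbouring sibling edges, at least one of which ends in a leaf of $\tilde T$, by one edge that keeps the descendants below the two; its type is (c), (d) or (e) according as only the right one, only the left one, or each of them ends in a leaf. Until $\tilde T$ is a single edge, repeat the following iteration. Step 1. For each vertex $v$ of $\tilde T$ with $k\ge 2$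 children $v_1,\dots,v_k$ and each $i=1,\dots,\lfloor k/2\rfloor$, merge $(v,v_{2i-1})$ and $(v,v_{2i})$ if $v_{2i-1}$ or $v_{2i}$ is a leaf; if $k$ is odd, $v_k$ is a leaf and $v_{k-2},v_{k-1}$ are not, also merge $(v,v_{k-1})$ and $(v,v_k)$. Step 2. For each maximal path $v_1,\dots,v_p$ in $\tilde T$ as it was at the beginning of the iteration, where $v_{i+1}$ is the parent of $v_i$ and $v_2,\dots,v_{p-1}$ have a single child, merge the pairs of edges $\{(v_1,v_2),(v_2,v_3)\},\{(v_3,v_4),(v_4,v_5)\},\dots$, leaving $(v_{p-1},v_p)$ alone if $p$ is even, and omitting the last pair $\{(v_{p-2},v_{p-1}),(v_{p-1},v_p)\}$ if $p$ is odd and $(v_{p-1},v_p)$ was merged in Step 1. (If $T$ has no edges, its top tree is empty.) The top DAG $\mathcal{TD}$ of $T$ is the minimal DAG of $\mathcal T$. **Theorem.** (i) There is an absolute constant $C$ such that every tree $T$, with minimal DAG $D$ and top DAG $\mathcal{TD}$, satisfies $n_{\mathcal{TD}}\le C\,\log n_T\cdot n_D$. (ii) Conversely, there are families of trees with $n_D=\Omega(n_T/\log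 n_T)\cdot n_{\mathcal{TD}}$: there is an absolute constant $c>0$ such that $n_D\ge c\,\frac{n_T}{\log n_T}\,n_{\mathcal{TD}}$ whenever all labels of $T$ are identical and $T$ is, for some $m\ge1$, the path with $m$ edges rooted at an endpoint, or, for some $m,k\ge 1$, the caterpillar with $m$ spine vertices each of which has $k$ leaf children followed by the next spine vertex (by one more leaf at the last spine vertex). -/

import Mathlib

universe u

namespace TopTrees

/-! ### Ordered labelled trees and their minimal DAGs -/

/-- Finite rooted ordered trees whose vertices carry labels in `α`: a label and the list of the
subtrees hanging from the root, from left to right. -/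
inductive OTree (α : Type u) : Type u
  | node : α → List (OTree α) → OTree α

namespace OTree

variable {α : Type u}

/-- The label of the root. -/
def label : OTree α → α
  | node a _ => a

/-- The subtrees hanging from the root, from left to right. -/
def children : OTree α → List (OTree α)
  | node _ ts => ts

/-- The root has no children. -/
def isLeaf (t : OTree α) : Bool := t.children.isEmpty

mutual
/-- The rooted subtrees `T(v)`, one entry for each vertex `v` of `T`, in preorder. -/
def subtrees : OTree α → List (OTree α)
  | node a ts => node a ts :: subtreesList ts
/-- The rooted subtrees of all trees of a forest. -/
def subtreesList : List (OTree α) → List (OTree α)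
  | [] => []
  | t :: ts => subtrees t ++ subtreesList ts
end

/-- `n_T`: the number of vertices plus the number of edges of `T`
(every edge is counted at its upper endpoint). -/
def treeSize (T : OTree α) : ℕ :=
  T.subtrees.length + (T.subtrees.map fun t => t.children.length).sum

open Classical in
/-- The vertices of the minimal DAG of `T`: the distinct rooted subtrees of `T`. -/
noncomputable def dagVertices (T : OTree α) : Finset (OTree α) := T.subtrees.toFinset

/-- The edges of the minimal DAG of `T`: a vertex `t` has one outgoing edge for each child
position `i` of its root, and that edge leads to the vertex `t.children[i]`. (So parallel edges
are counted with multiplicity, as is necessary for the DAG to determine the ordered tree.) -/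
noncomputable def dagEdges (T : OTree α) : Finset (Σ _ : OTree α, ℕ) :=
  T.dagVertices.sigma fun t => Finset.range t.children.length

/-- `n_D`: the number of vertices plus the number of edges of the minimal DAG of `T`. -/
noncomputable def dagSize (T : OTree α) : ℕ := T.dagVertices.card + T.dagEdges.card

end OTree

open OTree

/-! ### Clusters and merges -/

/-- The five types of merges. Vertical merges of an upper cluster with a lower one:
`a` if the lower cluster has a bottom boundary node, `b` if it has none. Horizontal merges of a
left cluster with a right one, having the same top boundary node: `c` if only the left cluster has
a bottom boundary node, `d` if only the right one has, `e` if neither has. -/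
inductive MergeType : Type
  | a | b | c | d | e

/-- Labels of top tree nodes: a leaf carries the pair (label of parent, label of child) of the
edge it stands for, an internal node carries its merge type. -/
abbrev TopLabel (α : Type u) : Type u := (α × α) ⊕ MergeType

/-- Top trees, and the subtrees they consist of during the construction, are themselves ordered
labelled trees. -/
abbrev Cluster (α : Type u) : Type u := OTree (TopLabel α)

/-- The auxiliary tree is represented by the list of the edges leaving its root, from left to
right; `node x es` is an edge carrying the datum `x`, whose lower endpoint has the outgoing
edges `es`. So each vertex other than the root is represented by the edge to its parent. -/
abbrev AuxTree (β : Type u) : Type u := List (OTree β)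

variable {α : Type u}

mutual
/-- The edge from a parent labelled `p` to the root of the given tree, and all edges below it,
each carrying the one-edge cluster it stands for. -/
def initEdge (p : α) : OTree α → OTree (Cluster α)
  | node q ts => node (node (Sum.inl (p, q)) []) (initEdges q ts)
/-- `initEdge` for all trees in a list. -/
def initEdges (p : α) : List (OTree α) → AuxTree (Cluster α)
  | [] => []
  | t :: ts => initEdge p t :: initEdges p ts
end

/-- The initial auxiliary tree: `T` itself. -/
def initAux (T : OTree α) : AuxTree (Cluster α) := initEdges T.label T.children

/-- Type of the horizontal merge of two sibling edges. -/
def horizontalType (leftIsLeaf rightIsLeaf : Bool) : MergeType :=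
  match leftIsLeaf, rightIsLeaf with
  | true, true => .e
  | false, _ => .c
  | true, false => .d

/-! ### Step 1: horizontal merges

In the course of an iteration an edge carries its cluster and a mark, which tells whether the edge
is the result of a merge in Step 1. -/

/-- Merge two neighbouring sibling edges. One of the two lower endpoints is a leaf, so the
concatenation is the list of the edges that leave the other lower endpoint. -/
def mergeSiblings : OTree (Cluster α × Bool) → OTree (Cluster α × Bool) →
    OTree (Cluster α × Bool)
  | node (x, _) es, node (y, _) fs =>
    node (node (Sum.inr (horizontalType es.isEmpty fs.isEmpty)) [x, y], true) (es ++ fs)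

/-- Step 1 at one vertex with outgoing edges `v₁, …, v_k`: for `i = 1, …, ⌊k/2⌋` the edges
`v_{2i-1}` and `v_{2i}` are merged if one of them ends in a leaf. If `k` is odd, `v_k` ends in a
leaf, and `v_{k-2}`, `v_{k-1}` do not, then `v_{k-1}` and `v_k` are merged. -/
def mergeRow : AuxTree (Cluster α × Bool) → AuxTree (Cluster α × Bool)
  | [] => []
  | [x] => [x]
  | [x, y, z] =>
    if x.isLeaf || y.isLeaf then [mergeSiblings x y, z]
    else if z.isLeaf then [x, mergeSiblings y z]
    else [x, y, z]
  | x :: y :: rest =>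
    if x.isLeaf || y.isLeaf then mergeSiblings x y :: mergeRow rest
    else x :: y :: mergeRow rest

mutual
/-- Step 1 at all vertices below the given edge. (`mergeRow` neither empties a nonempty list nor
creates edges from an empty one, so leaves can be recognized after the recursive calls.) -/
def horizontalEdge : OTree (Cluster α) → OTree (Cluster α × Bool)
  | node x es => node (x, false) (mergeRow (horizontalEdges es))
/-- `horizontalEdge` for all edges in a list. -/
def horizontalEdges : AuxTree (Cluster α) → AuxTree (Cluster α × Bool)
  | [] => []
  | t :: ts => horizontalEdge t :: horizontalEdges ts
end

/-- Step 1 at all vertices of the auxiliary tree. -/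
def horizontalStep (F : AuxTree (Cluster α)) : AuxTree (Cluster α × Bool) :=
  mergeRow (horizontalEdges F)

/-! ### Step 2: vertical merges

The maximal paths are those of the auxiliary tree at the beginning of the iteration. Their edges
`(v₁,v₂), (v₂,v₃), …` are paired from the bottom `v₁` upwards, and only the topmost edge
`(v_{p-1},v_p)` of a path can have been merged in Step 1, in which case it is not merged again. -/

/-- After Step 1 a vertex has exactly one outgoing edge, and this edge is unmarked, if and only if
the vertex had exactly one outgoing edge at the beginning of the iteration. -/
def isSingleUnmarked : AuxTree (Cluster α × Bool) → Bool
  | [node (_, false) _] => true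
  | _ => false

/-- Treat an edge with cluster `x` and mark `marked`, when everything below it has been treated.
Here `single` tells whether its lower endpoint had exactly one outgoing edge at the beginning of
the iteration, and `below` lists the edges that now leave its lower endpoint, each with the
information whether it is the result of a merge in Step 2. The edge is merged with the edge
below it if that is the only one, and neither of the two has been merged before. The second
component of the output tells whether the edge has been merged here. -/
def joinBelow (x : Cluster α) (marked single : Bool) (below : List (OTree (Cluster α) × Bool)) :
    OTree (Cluster α) × Bool :=
  match marked, single, below with
  | false, true, [(node y fs, false)] =>
    (node (node (Sum.inr (if fs.isEmpty then .b else .a)) [x, y]) fs, true)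
  | _, _, below => (node x (below.map Prod.fst), false)

mutual
/-- Step 2 on the given edge and everything below it; the second component tells whether the
edge is the result of a merge in Step 2. -/
def verticalEdge : OTree (Cluster α × Bool) → OTree (Cluster α) × Bool
  | node (x, marked) es => joinBelow x marked (isSingleUnmarked es) (verticalEdges es)
/-- `verticalEdge` for all edges in a list. -/
def verticalEdges : AuxTree (Cluster α × Bool) → List (OTree (Cluster α) × Bool)
  | [] => []
  | t :: ts => verticalEdge t :: verticalEdges ts
end

/-- Step 2 on the whole auxiliary tree. -/
def verticalStep (F : AuxTree (Cluster α × Bool)) : AuxTree (Cluster α) :=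
  (verticalEdges F).map Prod.fst

/-! ### The greedy construction -/

/-- One iteration: Step 1, then Step 2. -/
def iteration (F : AuxTree (Cluster α)) : AuxTree (Cluster α) := verticalStep (horizontalStep F)

/-- The cluster on the only edge of a one-edge auxiliary tree. -/
def onlyCluster : AuxTree (Cluster α) → Option (Cluster α)
  | [node x []] => some x
  | _ => none

/-- The top tree of `T`: iterate until the auxiliary tree is a single edge. An iteration does not
change a single edge and shrinks all larger trees, so that as many iterations as `T` has vertices
suffice; see `exists_topTree`. A tree without edges has no clusters, and its top tree is empty,
that is, `none`. -/
def topTree (T : OTree α) : Option (Cluster α) :=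
  onlyCluster (iteration^[T.subtrees.length] (initAux T))

/-- `n_TD`: the number of vertices plus the number of edges of the top DAG of `T`, which is the
minimal DAG of the top tree of `T` (and empty if the top tree is). -/
noncomputable def topDagSize (T : OTree α) : ℕ :=
  match topTree T with
  | some t => t.dagSize
  | none => 0

/-! ### The construction yields a top tree -/

/-- The number of edges of an auxiliary tree. -/
abbrev edgeCount {β : Type u} (F : AuxTree β) : ℕ := (subtreesList F).length

section construction

variable {β : Type u}

theorem edgeCount_cons (x : β) (es F : AuxTree β) :
    edgeCount (node x es :: F) = 1 + edgeCount es + edgeCount F := by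
  simp [edgeCount, subtreesList, subtrees]; omega

theorem edgeCount_cons' (t : OTree β) (F : AuxTree β) :
    edgeCount (t :: F) = edgeCount [t] + edgeCount F := by
  simp [edgeCount, subtreesList]

theorem edgeCount_nil : edgeCount ([] : AuxTree β) = 0 := rfl

theorem edgeCount_append (F G : AuxTree β) : edgeCount (F ++ G) = edgeCount F + edgeCount G := by
  induction F with
  | nil => simp [edgeCount, subtreesList]
  | cons t F ih => rw [List.cons_append, edgeCount_cons', ih, edgeCount_cons' t F]; omega

theorem edgeCount_mergeSiblings (t s : OTree (Cluster α × Bool)) :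
    edgeCount [mergeSiblings t s] + 1 = edgeCount [t] + edgeCount [s] := by
  obtain ⟨⟨x, b⟩, es⟩ := t
  obtain ⟨⟨y, c⟩, fs⟩ := s
  simp only [mergeSiblings, edgeCount_cons, edgeCount_nil, edgeCount_append]; omega

theorem mergeRow_eq_or_lt (F : AuxTree (Cluster α × Bool)) :
    (mergeRow F = F ∧ ∀ x y l, F = x :: y :: l → x.isLeaf = false ∧ y.isLeaf = false) ∨
      edgeCount (mergeRow F) < edgeCount F := by
  fun_induction mergeRow F with
  | case1 => left; simp
  | case2 => left; simp
  | case3 x y z h =>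
    right
    have := edgeCount_mergeSiblings x y
    rw [edgeCount_cons', edgeCount_cons' x, edgeCount_cons' y]; omega
  | case4 x y z h h' =>
    right
    have := edgeCount_mergeSiblings y z
    rw [edgeCount_cons' x [mergeSiblings y z], edgeCount_cons' x [y, z], edgeCount_cons' y [z]]
    omega
  | case5 x y z h h' => left; simp_all
  | case6 x y rest hr h ih =>
    right
    have := edgeCount_mergeSiblings x y
    rw [edgeCount_cons', edgeCount_cons' x, edgeCount_cons' y]
    rcases ih with ih | ih
    · rw [ih.1]; omega
    · omega
  | case7 x y rest hr h ih =>
    rcases ih with ih | ih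
    · left; rw [ih.1]; simp_all
    · right
      rw [edgeCount_cons' x (y :: mergeRow rest), edgeCount_cons' x (y :: rest),
        edgeCount_cons' y (mergeRow rest), edgeCount_cons' y rest]
      omega

theorem mergeRow_le (F : AuxTree (Cluster α × Bool)) : edgeCount (mergeRow F) ≤ edgeCount F := by
  rcases mergeRow_eq_or_lt F with h | h
  · rw [h.1]
  · exact h.le

theorem mergeRow_ne_nil {F : AuxTree (Cluster α × Bool)} (h : F ≠ []) : mergeRow F ≠ [] := by
  fun_cases mergeRow F <;> simp_all

mutual
theorem horizontalEdge_le : ∀ t : OTree (Cluster α), edgeCount [horizontalEdge t] ≤ edgeCount [t]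
  | node x es => by
    have h := horizontalEdges_le es
    have h' := mergeRow_le (horizontalEdges es)
    simp only [horizontalEdge, edgeCount_cons, edgeCount_nil]; omega
theorem horizontalEdges_le :
    ∀ F : AuxTree (Cluster α), edgeCount (horizontalEdges F) ≤ edgeCount F
  | [] => by simp [horizontalEdges, edgeCount, subtreesList]
  | t :: ts => by
    have h := horizontalEdge_le t
    have h' := horizontalEdges_le ts
    rw [horizontalEdges, edgeCount_cons', edgeCount_cons' t]; omega
end

theorem joinBelow_le (x : Cluster α) (m s : Bool) (l : List (OTree (Cluster α) × Bool)) :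
    edgeCount [(joinBelow x m s l).1] ≤ 1 + edgeCount (l.map Prod.fst) := by
  unfold joinBelow
  split <;> simp [edgeCount_cons, edgeCount_nil]

mutual
theorem verticalEdge_le :
    ∀ t : OTree (Cluster α × Bool), edgeCount [(verticalEdge t).1] ≤ edgeCount [t]
  | node (x, m) es => by
    have h := verticalStep_le es
    have h' := joinBelow_le x m (isSingleUnmarked es) (verticalEdges es)
    rw [verticalStep] at h
    simp only [verticalEdge, edgeCount_cons, edgeCount_nil] at *; omega
theorem verticalStep_le :
    ∀ F : AuxTree (Cluster α × Bool), edgeCount (verticalStep F) ≤ edgeCount F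
  | [] => by simp [verticalStep, verticalEdges, edgeCount, subtreesList]
  | t :: ts => by
    have h := verticalEdge_le t
    have h' := verticalStep_le ts
    rw [verticalStep] at *
    rw [verticalEdges, List.map_cons, edgeCount_cons', edgeCount_cons' t]; omega
end

theorem horizontalEdge_isLeaf (t : OTree (Cluster α)) : (horizontalEdge t).isLeaf = t.isLeaf := by
  obtain ⟨x, es⟩ := t
  cases es with
  | nil => simp [horizontalEdge, horizontalEdges, mergeRow, isLeaf, children]
  | cons e es =>
    have : mergeRow (horizontalEdges (e :: es)) ≠ [] := mergeRow_ne_nil (by simp [horizontalEdges])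
    simp [horizontalEdge, isLeaf, children, this]

/-- All edges with a nonleaf lower endpoint lose edges below or by being merged. -/
theorem vertical_horizontal_lt (F : AuxTree (Cluster α))
    (hF : ∀ t ∈ F, t.isLeaf = false → edgeCount [(verticalEdge (horizontalEdge t)).1] < edgeCount [t])
    (hex : ∃ t ∈ F, t.isLeaf = false) :
    edgeCount (verticalStep (horizontalEdges F)) < edgeCount F := by
  induction F with
  | nil => simp at hex
  | cons t F ih =>
    have e : edgeCount (verticalStep (horizontalEdges (t :: F))) =
        edgeCount [(verticalEdge (horizontalEdge t)).1] +
          edgeCount (verticalStep (horizontalEdges F)) := by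
      rw [verticalStep, verticalStep, horizontalEdges, verticalEdges, List.map_cons,
        edgeCount_cons']
    rw [e, edgeCount_cons' t]
    have h1 := (verticalEdge_le (horizontalEdge t)).trans (horizontalEdge_le t)
    have h2 := (verticalStep_le (horizontalEdges F)).trans (horizontalEdges_le F)
    by_cases ht : t.isLeaf = false
    · have := hF t (by simp) ht
      omega
    · have := ih (fun s hs => hF s (by simp [hs])) (by simpa [ht] using hex)
      omega

theorem iteration_lt_of_forall (F : AuxTree (Cluster α))
    (hF : ∀ t ∈ F, t.isLeaf = false → edgeCount [(verticalEdge (horizontalEdge t)).1] < edgeCount [t])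
    (h0 : F ≠ []) (h1 : ∀ x, F ≠ [node x []]) :
    edgeCount (iteration F) < edgeCount F := by
  unfold iteration horizontalStep
  rcases mergeRow_eq_or_lt (horizontalEdges F) with ⟨h, h'⟩ | h
  · rw [h]
    apply vertical_horizontal_lt F hF
    match F, h0 with
    | [t], _ =>
      refine ⟨t, by simp, ?_⟩
      obtain ⟨x, es⟩ := t
      cases es with
      | nil => exact absurd rfl (h1 x)
      | cons e es => rfl
    | t :: s :: G, _ =>
      refine ⟨t, by simp, ?_⟩
      rw [← horizontalEdge_isLeaf]
      exact (h' _ _ _ (by rw [horizontalEdges, horizontalEdges])).1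
  · exact ((verticalStep_le _).trans_lt h).trans_le (horizontalEdges_le F)

mutual
theorem edge_lt : ∀ t : OTree (Cluster α), t.isLeaf = false →
    edgeCount [(verticalEdge (horizontalEdge t)).1] < edgeCount [t]
  | node x es, ht => by
    by_cases h1 : ∃ y, es = [node y []]
    · obtain ⟨y, rfl⟩ := h1
      simp [horizontalEdge, horizontalEdges, mergeRow, verticalEdge, verticalEdges, joinBelow,
        isSingleUnmarked, edgeCount, subtreesList, subtrees]
    · have h0 : es ≠ [] := by rintro rfl; simp [isLeaf, children] at ht
      have h := iteration_lt_of_forall es (edges_lt es) h0 (by simpa using h1)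
      have h' := joinBelow_le x false (isSingleUnmarked (mergeRow (horizontalEdges es)))
        (verticalEdges (mergeRow (horizontalEdges es)))
      unfold iteration verticalStep horizontalStep at h
      simp only [horizontalEdge, verticalEdge]
      rw [edgeCount_cons x es, edgeCount_nil]; omega
theorem edges_lt : ∀ F : AuxTree (Cluster α), ∀ t ∈ F, t.isLeaf = false →
    edgeCount [(verticalEdge (horizontalEdge t)).1] < edgeCount [t]
  | [] => by simp
  | s :: F => by
    intro t ht
    rcases List.mem_cons.1 ht with h | h
    · rw [h]; exact edge_lt s
    · exact edges_lt F t h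
end

/-- An iteration shrinks every auxiliary tree with at least two edges. -/
theorem iteration_lt (F : AuxTree (Cluster α)) (h0 : F ≠ []) (h1 : ∀ x, F ≠ [node x []]) :
    edgeCount (iteration F) < edgeCount F :=
  iteration_lt_of_forall F (edges_lt F) h0 h1

/-- An iteration does not change a single edge. -/
theorem iteration_single (x : Cluster α) : iteration [node x []] = [node x []] := by
  simp [iteration, horizontalStep, horizontalEdges, horizontalEdge, mergeRow, verticalStep,
    verticalEdges, verticalEdge, joinBelow, isSingleUnmarked]

theorem iteration_ne_nil {F : AuxTree (Cluster α)} (h : F ≠ []) : iteration F ≠ [] := by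
  unfold iteration horizontalStep verticalStep
  have h1 : mergeRow (horizontalEdges F) ≠ [] :=
    mergeRow_ne_nil (by cases F <;> simp_all [horizontalEdges])
  cases h2 : mergeRow (horizontalEdges F) with
  | nil => exact absurd h2 h1
  | cons t G => simp [verticalEdges]

theorem exists_iterate_eq_single (n : ℕ) (F : AuxTree (Cluster α)) (h0 : F ≠ [])
    (hn : edgeCount F ≤ n) : ∃ x, iteration^[n] F = [node x []] := by
  induction n generalizing F with
  | zero =>
    match F, h0 with
    | node x es :: G, _ => rw [edgeCount_cons] at hn; omega
  | succ n ih =>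
    rw [Function.iterate_succ_apply]
    by_cases h1 : ∃ x, F = [node x []]
    · obtain ⟨x, rfl⟩ := h1
      rw [iteration_single]
      exact ⟨x, Function.iterate_fixed (iteration_single x) n⟩
    · have := iteration_lt F h0 (by simpa using h1)
      exact ih _ (iteration_ne_nil h0) (by omega)

mutual
theorem edgeCount_initEdge (p : α) :
    ∀ t : OTree α, edgeCount [initEdge p t] = t.subtrees.length
  | node q ts => by
    have := edgeCount_initEdges q ts
    simp only [initEdge, edgeCount_cons, edgeCount_nil, subtrees, List.length_cons]; omega
theorem edgeCount_initEdges (p : α) :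
    ∀ ts : List (OTree α), edgeCount (initEdges p ts) = (subtreesList ts).length
  | [] => rfl
  | t :: ts => by
    have h := edgeCount_initEdge p t
    have h' := edgeCount_initEdges p ts
    rw [initEdges, edgeCount_cons', h, h', subtreesList, List.length_append]
end

/-- Every tree with at least one edge has a top tree. -/
theorem exists_topTree (T : OTree α) (hT : T.children ≠ []) : ∃ t, topTree T = some t := by
  obtain ⟨a, ts⟩ := T
  have h0 : initAux (node a ts) ≠ [] := by
    cases ts with
    | nil => simp [children] at hT
    | cons t ts => simp [initAux, children, initEdges]
  obtain ⟨x, hx⟩ := exists_iterate_eq_single (subtrees (node a ts)).length _ h0 (by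
    simp only [initAux, children, label, edgeCount_initEdges, subtrees, List.length_cons]; omega)
  exact ⟨x, by rw [topTree, hx, onlyCluster]⟩

end construction

/-! ### Paths and caterpillars with identical labels -/

/-- The path with `m` edges, rooted at an endpoint, all labels being `a`. -/
def path (a : α) : ℕ → OTree α
  | 0 => node a []
  | m + 1 => node a [path a m]

/-- The caterpillar with `m` spine vertices, all labels being `a`: each spine vertex has `k`
leaf children, followed by the next spine vertex, or by one more leaf at the end of the spine. -/
def caterpillar (a : α) (k : ℕ) : ℕ → OTree α
  | 0 => node a []
  | m + 1 => node a (List.replicate k (node a []) ++ [caterpillar a k m])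

end TopTrees

open TopTrees TopTrees.OTree

/-!
Part (i) rests on locality. Step 1 at a vertex and Step 2 below it depend only on the auxiliary tree
below that vertex, so that a vertex `v` of `T` which is still present after `i` iterations has below
it exactly the auxiliary tree that `i` iterations make of the subtree `T(v)` alone
(`Over.iteration`, `over_iterate`). Therefore the clusters with top boundary node `v` after `i`
iterations are determined by `i` and the isomorphism type of `T(v)`, and there are at most as many of
them as `v` has children: after each iteration there are at most as many distinct clusters as the
minimal DAG has edges (`exists_clusters_subset`). Every subtree of the top tree is a cluster that is
present after some iteration (`subtrees_of_mem_clusters`), and the top tree is binary, so the size of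
the top DAG is at most three times this number, times the number of iterations plus one
(`topDagSize_le`).

The number of iterations is logarithmic, because an iteration removes at least one sixth of the edges
of an auxiliary tree with more than one edge (`edgeCount_iteration_le`). This is proved by structural
induction with a bound that has some room left. The room is larger for an edge merged in Step 2,
because this merge is lost when a horizontal merge with a sibling takes precedence (`ShrinksTo`).

For part (ii), a path is a caterpillar without legs, and an iteration preserves the shape of a
caterpillar: it halves the number of legs at each spine vertex or, when none are left, the length of
the spine. All leg edges carry the same cluster, and so do all spine edges except for the topmost and
the lowest one (`IsSpine`, `exists_iteration_comb`). So at most four distinct clusters are present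
after each iteration, and the top DAG has logarithmic size, whereas the minimal DAG is at least half
as large as the tree since all spine vertices are roots of distinct subtrees.
-/

namespace TopTrees

variable {α : Type u}

/-! ### An iteration shrinks the auxiliary tree by a constant factor -/

theorem horizontalEdges_eq_map (F : AuxTree (Cluster α)) :
    horizontalEdges F = F.map horizontalEdge := by
  induction F with
  | nil => rfl
  | cons t F ih => rw [horizontalEdges, ih, List.map_cons]

theorem verticalEdges_eq_map (F : AuxTree (Cluster α × Bool)) :
    verticalEdges F = F.map verticalEdge := by
  induction F with
  | nil => rfl
  | cons t F ih => rw [verticalEdges, ih, List.map_cons]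

theorem verticalStep_cons (t : OTree (Cluster α × Bool)) (F : AuxTree (Cluster α × Bool)) :
    verticalStep (t :: F) = (verticalEdge t).1 :: verticalStep F := rfl

/-- A merge in Step 2 saves exactly one edge. -/
theorem edgeCount_joinBelow (x : Cluster α) (m s : Bool) (l : List (OTree (Cluster α) × Bool)) :
    edgeCount [(joinBelow x m s l).1] + (joinBelow x m s l).2.toNat =
      1 + edgeCount (l.map Prod.fst) := by
  unfold joinBelow
  split
  · simp [edgeCount_cons, edgeCount_nil]
    omega
  · simp [edgeCount_cons, edgeCount_nil]

theorem edgeCount_verticalEdge (x : Cluster α) (m : Bool) (es : AuxTree (Cluster α × Bool)) :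
    edgeCount [(verticalEdge (node (x, m) es)).1] + (verticalEdge (node (x, m) es)).2.toNat =
      1 + edgeCount (verticalStep es) := by
  rw [verticalEdge]
  exact edgeCount_joinBelow ..

theorem edgeCount_verticalEdge_marked (x : Cluster α) (es : AuxTree (Cluster α × Bool)) :
    edgeCount [(verticalEdge (node (x, true) es)).1] = 1 + edgeCount (verticalStep es) := by
  rw [verticalEdge]
  simp [joinBelow, edgeCount_cons, edgeCount_nil, verticalStep]

/-- The inductive claim about an edge `r` after Step 1 that stands for `n` edges at the beginning
of the iteration (itself and those below it). For a nonleaf edge, Step 2 leaves at most `5 / 6` of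
them, with some room: one unit, and three more if the edge has been merged in Step 2. The three
units pay for losing that merge if instead the edge takes part in a merge with a sibling. -/
def ShrinksTo (r : OTree (Cluster α × Bool)) (n : ℕ) : Prop :=
  1 ≤ n ∧ (r.isLeaf = false →
    n + 1 + 3 * (verticalEdge r).2.toNat + 6 * edgeCount [(verticalEdge r).1] ≤ 6 * n)

theorem ShrinksTo.le {r : OTree (Cluster α × Bool)} {n : ℕ} (h : ShrinksTo r n) :
    n + 6 * edgeCount [(verticalEdge r).1] ≤ 6 * n + 1 := by
  obtain ⟨h1, h2⟩ := h
  obtain ⟨⟨x, m⟩, es⟩ := r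
  cases es with
  | nil => simp [verticalEdge, joinBelow, isSingleUnmarked, verticalEdges, edgeCount, subtreesList,
      subtrees]; omega
  | cons e es => have := h2 rfl; omega

/-- A merge of two siblings leaves room for three units. -/
theorem ShrinksTo.mergeSiblings {r s : OTree (Cluster α × Bool)} {n k : ℕ}
    (hr : ShrinksTo r n) (hs : ShrinksTo s k) (h : (r.isLeaf || s.isLeaf) = true) :
    n + k + 3 + 6 * edgeCount [(verticalEdge (mergeSiblings r s)).1] ≤ 6 * (n + k) := by
  obtain ⟨⟨x, m⟩, es⟩ := r
  obtain ⟨⟨y, l⟩, fs⟩ := s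
  obtain ⟨hr1, hr2⟩ := hr
  obtain ⟨hs1, hs2⟩ := hs
  have er := edgeCount_verticalEdge x m es
  have es' := edgeCount_verticalEdge y l fs
  have br := Bool.toNat_le (verticalEdge (node (x, m) es)).2
  have bs := Bool.toNat_le (verticalEdge (node (y, l) fs)).2
  rw [TopTrees.mergeSiblings, edgeCount_verticalEdge_marked]
  cases es with
  | nil =>
    cases fs with
    | nil => simp [verticalStep, verticalEdges, edgeCount_nil]; omega
    | cons f fs => have := hs2 rfl; rw [List.nil_append]; omega
  | cons e es =>
    cases fs with
    | nil => have := hr2 rfl; rw [List.append_nil]; omega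
    | cons f fs => simp [isLeaf, children] at h

theorem edgeCount_verticalStep_cons (t : OTree (Cluster α × Bool))
    (F : AuxTree (Cluster α × Bool)) :
    edgeCount (verticalStep (t :: F)) =
      edgeCount [(verticalEdge t).1] + edgeCount (verticalStep F) := by
  rw [verticalStep_cons, edgeCount_cons']

theorem edgeCount_verticalStep_nil :
    edgeCount (verticalStep ([] : AuxTree (Cluster α × Bool))) = 0 := rfl

/-- At a vertex with at least two children, there is room for two units: a leaf that is left over
costs one unit, and then there is a merge of siblings. -/
theorem edgeCount_mergeRow_le (R : AuxTree (Cluster α × Bool)) (ns : List ℕ)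
    (h : List.Forall₂ ShrinksTo R ns) (hR : R.length ≠ 1) :
    ns.sum + (if R = [] then 0 else 2) + 6 * edgeCount (verticalStep (mergeRow R)) ≤
      6 * ns.sum := by
  fun_induction mergeRow R generalizing ns with
  | case1 => cases h; simp [verticalStep, verticalEdges, edgeCount_nil]
  | case2 => simp at hR
  | case3 x y z hl =>
    obtain _ | ⟨hx, _ | ⟨hy, _ | ⟨hz, _ | _⟩⟩⟩ := h
    have := hx.mergeSiblings hy hl
    have := hz.le
    simp only [edgeCount_verticalStep_cons, edgeCount_verticalStep_nil, List.sum_cons, List.sum_nil,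
      reduceCtorEq, if_false]
    omega
  | case4 x y z hl hl' =>
    obtain _ | ⟨hx, _ | ⟨hy, _ | ⟨hz, _ | _⟩⟩⟩ := h
    have := hy.mergeSiblings hz (by simp [hl'])
    have := hx.le
    simp only [edgeCount_verticalStep_cons, edgeCount_verticalStep_nil, List.sum_cons, List.sum_nil,
      reduceCtorEq, if_false]
    omega
  | case5 x y z hl hl' =>
    obtain _ | ⟨hx, _ | ⟨hy, _ | ⟨hz, _ | _⟩⟩⟩ := h
    simp only [Bool.or_eq_true, not_or, Bool.not_eq_true] at hl hl'
    have := hx.2 hl.1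
    have := hy.2 hl.2
    have := hz.2 hl'
    simp only [edgeCount_verticalStep_cons, edgeCount_verticalStep_nil, List.sum_cons, List.sum_nil,
      reduceCtorEq, if_false]
    omega
  | case6 x y rest hr hl ih =>
    obtain _ | ⟨hx, _ | ⟨hy, hrest⟩⟩ := h
    have := hx.mergeSiblings hy hl
    have := ih _ hrest (by
      rw [Ne, List.length_eq_one_iff]; rintro ⟨z, rfl⟩; exact hr z rfl)
    simp only [edgeCount_verticalStep_cons, List.sum_cons, reduceCtorEq, if_false]
    omega
  | case7 x y rest hr hl ih =>
    obtain _ | ⟨hx, _ | ⟨hy, hrest⟩⟩ := h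
    simp only [Bool.or_eq_true, not_or, Bool.not_eq_true] at hl
    have := hx.2 hl.1
    have := hy.2 hl.2
    have := ih _ hrest (by
      rw [Ne, List.length_eq_one_iff]; rintro ⟨z, rfl⟩; exact hr z rfl)
    simp only [edgeCount_verticalStep_cons, List.sum_cons, reduceCtorEq, if_false]
    omega

theorem sum_map_edgeCount {β : Type u} (F : AuxTree β) :
    (F.map fun t => edgeCount [t]).sum = edgeCount F := by
  induction F with
  | nil => rfl
  | cons t F ih => rw [List.map_cons, List.sum_cons, ih, edgeCount_cons' t F]

mutual
theorem shrinksTo_horizontalEdge :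
    ∀ t : OTree (Cluster α), ShrinksTo (horizontalEdge t) (edgeCount [t])
  | node x es => by
    refine ⟨by rw [edgeCount_cons]; omega, fun hl => ?_⟩
    rw [horizontalEdge_isLeaf] at hl
    have hrow := shrinksTo_horizontalEdges es
    match es, hrow with
    | [], _ => simp [isLeaf, children] at hl
    | [node y fs], hrow =>
      obtain _ | ⟨⟨h1, h2⟩, _⟩ := hrow
      dsimp only at h1 h2
      have hleaf : (horizontalEdge (node y fs)).isLeaf = true →
          edgeCount [(verticalEdge (horizontalEdge (node y fs))).1] = 1 ∧
            (verticalEdge (horizontalEdge (node y fs))).2 = false := by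
        intro h
        rw [horizontalEdge_isLeaf] at h
        cases fs with
        | nil => simp [horizontalEdge, horizontalEdges, mergeRow, verticalEdge, verticalEdges,
            joinBelow, isSingleUnmarked, edgeCount, subtreesList, subtrees]
        | cons => simp [isLeaf, children] at h
      have hv : verticalEdge (horizontalEdge (node x [node y fs])) =
          joinBelow x false true [verticalEdge (horizontalEdge (node y fs))] := by
        simp [horizontalEdge, horizontalEdges, mergeRow, verticalEdge, verticalEdges,
          isSingleUnmarked]
      have hc := edgeCount_joinBelow x false true [verticalEdge (horizontalEdge (node y fs))]
      have hm : (joinBelow x false true [verticalEdge (horizontalEdge (node y fs))]).2 =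
          !(verticalEdge (horizontalEdge (node y fs))).2 := by
        rcases verticalEdge (horizontalEdge (node y fs)) with ⟨⟨z, gs⟩, _ | _⟩ <;> rfl
      rw [hv, edgeCount_cons x, edgeCount_nil]
      simp only [List.map_cons, List.map_nil] at hc
      cases hb : (verticalEdge (horizontalEdge (node y fs))).2 <;>
        cases hb' : (horizontalEdge (node y fs)).isLeaf <;>
        simp [hb, hb', hm] at hc h2 hleaf ⊢ <;> omega
    | e :: e' :: es, hrow =>
      have h := edgeCount_mergeRow_le _ _ hrow (by simp [horizontalEdges_eq_map])
      rw [sum_map_edgeCount] at h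
      have hc := edgeCount_verticalEdge x false (mergeRow (horizontalEdges (e :: e' :: es)))
      simp only [horizontalEdges, reduceCtorEq, if_false] at h hc
      rw [horizontalEdge, edgeCount_cons x, edgeCount_nil]
      simp only [horizontalEdges]
      omega
theorem shrinksTo_horizontalEdges : ∀ F : AuxTree (Cluster α),
    List.Forall₂ ShrinksTo (horizontalEdges F) (F.map fun t => edgeCount [t])
  | [] => .nil
  | t :: F => .cons (shrinksTo_horizontalEdge t) (shrinksTo_horizontalEdges F)
end

/-- An iteration removes at least one sixth of the edges, unless there is only one. -/
theorem edgeCount_iteration_le (F : AuxTree (Cluster α)) (h1 : ∀ x, F ≠ [node x []]) :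
    6 * edgeCount (iteration F) ≤ 5 * edgeCount F := by
  have hrow := shrinksTo_horizontalEdges F
  match F, hrow with
  | [], _ => simp [iteration, horizontalStep, horizontalEdges, mergeRow, verticalStep,
      verticalEdges, edgeCount_nil]
  | [node y fs], hrow =>
    obtain _ | ⟨⟨-, h2⟩, _⟩ := hrow
    dsimp only at h2
    have h3 := h2 (by
      rw [horizontalEdge_isLeaf]
      cases fs with
      | nil => exact absurd rfl (h1 y)
      | cons => rfl)
    have : iteration [node y fs] = [(verticalEdge (horizontalEdge (node y fs))).1] := by
      simp [iteration, horizontalStep, horizontalEdges, mergeRow, verticalStep, verticalEdges]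
    rw [this]
    omega
  | e :: e' :: es, hrow =>
    have h := edgeCount_mergeRow_le _ _ hrow (by simp [horizontalEdges_eq_map])
    rw [sum_map_edgeCount] at h
    rw [iteration, horizontalStep]
    omega

theorem edgeCount_pos {β : Type u} {F : AuxTree β} (h : F ≠ []) : 0 < edgeCount F := by
  match F, h with
  | node x es :: F, _ => rw [edgeCount_cons]; omega

/-- Logarithmically many iterations suffice. -/
theorem exists_iterate_eq_single_of_le_pow (N : ℕ) (F : AuxTree (Cluster α)) (h0 : F ≠ [])
    (hN : (edgeCount F : ℝ) ≤ (6 / 5) ^ N) : ∃ x, iteration^[N] F = [node x []] := by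
  induction N generalizing F with
  | zero =>
    have h4 : edgeCount F ≤ 1 := by rw [pow_zero] at hN; exact_mod_cast hN
    refine exists_iterate_eq_single 1 F h0 h4 |>.imp fun x hx => ?_
    by_contra hF
    by_cases h1 : ∃ y, F = [node y []]
    · obtain ⟨y, rfl⟩ := h1
      rw [Function.iterate_one, iteration_single] at hx
      exact hF hx
    · have h2 := iteration_lt F h0 (by simpa using h1)
      have h3 := edgeCount_pos (iteration_ne_nil h0)
      omega
  | succ N ih =>
    rw [Function.iterate_succ_apply]
    by_cases h1 : ∃ x, F = [node x []]
    · obtain ⟨x, rfl⟩ := h1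
      rw [iteration_single]
      exact ⟨x, Function.iterate_fixed (iteration_single x) N⟩
    · have h2 := edgeCount_iteration_le F (by simpa using h1)
      have h3 : (6 : ℝ) * edgeCount (iteration F) ≤ 5 * edgeCount F := by exact_mod_cast h2
      refine ih _ (iteration_ne_nil h0) ?_
      rw [pow_succ] at hN
      linarith

/-! ### Labels and child lists of the iterates -/

/-- Every edge of `F` carries a datum in `L`, and the list of the edges that leave its lower
endpoint belongs to `K`. -/
def Over {β : Type u} (L : Set β) (K : Set (AuxTree β)) (F : AuxTree β) : Prop :=
  ∀ t ∈ subtreesList F, t.label ∈ L ∧ t.children ∈ K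

section Over

variable {β : Type u} {L : Set β} {K : Set (AuxTree β)}

theorem over_nil : Over L K [] := by simp [Over, subtreesList]

theorem over_cons_node {x : β} {es F : AuxTree β} :
    Over L K (node x es :: F) ↔ (x ∈ L ∧ es ∈ K ∧ Over L K es) ∧ Over L K F := by
  simp only [Over, subtreesList, subtrees, List.cons_append, List.mem_cons, List.mem_append,
    or_imp, forall_and, forall_eq]
  rw [show (node x es).label = x from rfl, show (node x es).children = es from rfl]
  tauto

theorem over_cons {t : OTree β} {F : AuxTree β} :
    Over L K (t :: F) ↔ Over L K [t] ∧ Over L K F := by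
  obtain ⟨x, es⟩ := t
  simp [over_cons_node, over_nil]

theorem over_append {F G : AuxTree β} : Over L K (F ++ G) ↔ Over L K F ∧ Over L K G := by
  induction F with
  | nil => simp [over_nil]
  | cons t F ih => rw [List.cons_append, over_cons, ih, over_cons (F := F)]; tauto

theorem over_iff_forall_mem {F : AuxTree β} : Over L K F ↔ ∀ t ∈ F, Over L K [t] := by
  induction F with
  | nil => simp [over_nil]
  | cons t F ih => rw [over_cons, ih]; simp

mutual
/-- If the edges leaving the root and those in the child lists in `K` carry data in `L`, then all
edges do, since every edge leaves the root or belongs to a child list. -/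
theorem over_of_root (hF : ∀ F ∈ K, ∀ t ∈ F, t.label ∈ L) :
    ∀ s : OTree β, Over Set.univ K [s] → s.label ∈ L → Over L K [s]
  | node x es, h, hx => by
    simp only [over_cons_node, over_nil, and_true] at h ⊢
    exact ⟨hx, h.2.1, over_of_roots hF es h.2.2 (hF es h.2.1)⟩
theorem over_of_roots (hF : ∀ F ∈ K, ∀ t ∈ F, t.label ∈ L) :
    ∀ F : AuxTree β, Over Set.univ K F → (∀ t ∈ F, t.label ∈ L) → Over L K F
  | [], _, _ => over_nil
  | s :: F, h, hx => by
    rw [over_cons] at h ⊢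
    exact ⟨over_of_root hF s h.1 (hx s (by simp)),
      over_of_roots hF F h.2 fun t ht => hx t (by simp [ht])⟩
end

end Over

/-- The clusters that arise by merging two clusters from `L`. -/
def merged (L : Set (Cluster α)) : Set (Cluster α) :=
  {z | ∃ m, ∃ x ∈ L, ∃ y ∈ L, z = node (Sum.inr m) [x, y]}

/-- The data on edges after Step 1: unmarked clusters from `L`, and marked merges of these. -/
def markedLabels (L : Set (Cluster α)) : Set (Cluster α × Bool) :=
  {p | (p.2 = false ∧ p.1 ∈ L) ∨ (p.2 = true ∧ p.1 ∈ merged L)}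

theorem mem_mergeRow {R : AuxTree (Cluster α × Bool)} {u : OTree (Cluster α × Bool)}
    (h : u ∈ mergeRow R) : u ∈ R ∨
      ∃ x ∈ R, ∃ y ∈ R, (x.isLeaf || y.isLeaf) = true ∧ u = mergeSiblings x y := by
  fun_induction mergeRow R <;> grind

theorem over_mergeSiblings {L : Set (Cluster α)} {K : Set (AuxTree (Cluster α × Bool))}
    {r s : OTree (Cluster α × Bool)} (hr : Over (markedLabels L) K [r])
    (hs : Over (markedLabels L) K [s]) (hr' : r.label.2 = false) (hs' : s.label.2 = false)
    (h : (r.isLeaf || s.isLeaf) = true) : Over (markedLabels L) K [mergeSiblings r s] := by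
  obtain ⟨⟨x, m⟩, es⟩ := r
  obtain ⟨⟨y, l⟩, fs⟩ := s
  simp only [label] at hr' hs'
  subst hr' hs'
  simp only [over_cons_node, over_nil, and_true, markedLabels, Set.mem_ofPred_eq] at hr hs
  simp only [mergeSiblings, over_cons_node, over_nil, and_true, over_append]
  refine ⟨Or.inr ⟨rfl, _, x, by simpa using hr.1, y, by simpa using hs.1, rfl⟩, ?_,
    hr.2.2, hs.2.2⟩
  simp only [isLeaf, children, Bool.or_eq_true, List.isEmpty_iff] at h
  rcases h with rfl | rfl
  · exact hs.2.1
  · rw [List.append_nil]; exact hr.2.1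

theorem over_mergeRow {L : Set (Cluster α)} {K : Set (AuxTree (Cluster α × Bool))}
    {R : AuxTree (Cluster α × Bool)} (hR : Over (markedLabels L) K R)
    (h : ∀ r ∈ R, r.label.2 = false) : Over (markedLabels L) K (mergeRow R) := by
  rw [over_iff_forall_mem] at hR ⊢
  intro u hu
  rcases mem_mergeRow hu with hu | ⟨x, hx, y, hy, hl, rfl⟩
  · exact hR u hu
  · exact over_mergeSiblings (hR x hx) (hR y hy) (h x hx) (h y hy) hl

theorem label_horizontalEdges (F : AuxTree (Cluster α)) :
    ∀ r ∈ horizontalEdges F, r.label.2 = false := by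
  rw [horizontalEdges_eq_map]
  simp only [List.mem_map]
  rintro _ ⟨⟨x, es⟩, -, rfl⟩
  rfl

mutual
theorem over_horizontalEdge {L : Set (Cluster α)} {K : Set (AuxTree (Cluster α))} :
    ∀ t : OTree (Cluster α), Over L K [t] →
      Over (markedLabels L) (horizontalStep '' K) [horizontalEdge t]
  | node x es, h => by
    simp only [horizontalEdge, over_cons_node, over_nil, and_true] at h ⊢
    exact ⟨Or.inl ⟨rfl, h.1⟩, ⟨es, h.2.1, rfl⟩,
      over_mergeRow (over_horizontalEdges es h.2.2) (label_horizontalEdges es)⟩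
theorem over_horizontalEdges {L : Set (Cluster α)} {K : Set (AuxTree (Cluster α))} :
    ∀ F : AuxTree (Cluster α), Over L K F →
      Over (markedLabels L) (horizontalStep '' K) (horizontalEdges F)
  | [], _ => over_nil
  | t :: F, h => by
    rw [over_cons] at h
    rw [horizontalEdges, over_cons]
    exact ⟨over_horizontalEdge t h.1, over_horizontalEdges F h.2⟩
end

theorem label_verticalEdge (x : Cluster α) (m : Bool) (es : AuxTree (Cluster α × Bool))
    (h : (verticalEdge (node (x, m) es)).2 = false) :
    (verticalEdge (node (x, m) es)).1.label = x := by
  rw [verticalEdge] at *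
  unfold joinBelow at *
  split <;> simp_all [label]

mutual
theorem over_verticalEdge {L : Set (Cluster α)} {K : Set (AuxTree (Cluster α × Bool))} :
    ∀ t : OTree (Cluster α × Bool), Over (markedLabels L) K [t] →
      Over (L ∪ merged L) (verticalStep '' K) [(verticalEdge t).1]
  | node (x, m) es, h => by
    simp only [over_cons_node, over_nil, and_true] at h
    obtain ⟨hx, hes, h⟩ := h
    have ih := over_verticalEdges es h
    have hx' : x ∈ L ∪ merged L := hx.imp And.right And.right
    have hdef : Over (L ∪ merged L) (verticalStep '' K) [node x (verticalStep es)] := by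
      simp only [over_cons_node, over_nil, and_true]
      exact ⟨hx', ⟨es, hes, rfl⟩, ih⟩
    rw [verticalEdge]
    unfold joinBelow
    split
    · rename_i y fs hs hv
      -- The edge below is unmarked and not merged in Step 2, so `y` is an old cluster.
      obtain ⟨y', gs, rfl⟩ : ∃ y' gs, es = [node (y', false) gs] := by
        unfold isSingleUnmarked at hs
        split at hs
        · exact ⟨_, _, rfl⟩
        · simp at hs
      simp only [verticalEdges, List.cons.injEq, and_true] at hv
      have hy : y = y' := by
        have := label_verticalEdge y' false gs (by rw [hv])
        rwa [hv] at this
      subst hy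
      simp only [verticalStep_cons, hv, over_cons_node] at ih
      simp only [over_cons_node, over_nil, and_true] at h ⊢
      refine ⟨Or.inr ⟨_, x, ?_, y, ?_, rfl⟩, ih.1.2⟩
      · simpa [markedLabels] using hx
      · simpa [markedLabels] using h.1
    · exact hdef
theorem over_verticalEdges {L : Set (Cluster α)} {K : Set (AuxTree (Cluster α × Bool))} :
    ∀ F : AuxTree (Cluster α × Bool), Over (markedLabels L) K F →
      Over (L ∪ merged L) (verticalStep '' K) (verticalStep F)
  | [], _ => over_nil
  | t :: F, h => by
    rw [over_cons] at h
    rw [verticalStep_cons, over_cons]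
    exact ⟨over_verticalEdge t h.1, over_verticalEdges F h.2⟩
end

/-- The crucial locality of an iteration: the edges leaving a surviving vertex are obtained by
iterating in isolation on what was below that vertex. Moreover, a cluster created by an
iteration is the merge of two clusters present before. -/
theorem Over.iteration {L : Set (Cluster α)} {K : Set (AuxTree (Cluster α))}
    {F : AuxTree (Cluster α)} (h : Over L K F) :
    Over (L ∪ merged L) (iteration '' K) (iteration F) := by
  have := over_verticalEdges _ (over_mergeRow (over_horizontalEdges F h) (label_horizontalEdges F))
  rwa [Set.image_image] at this

mutual
theorem over_initEdge (p : α) : ∀ t : OTree α,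
    Over {x | ∃ l, x = node (Sum.inl l) []} {F | ∃ s ∈ t.subtrees, F = initAux s} [initEdge p t]
  | node q ts => by
    simp only [initEdge, over_cons_node, over_nil, and_true]
    refine ⟨⟨_, rfl⟩, ⟨node q ts, by simp [subtrees], rfl⟩, fun u hu => ?_⟩
    obtain ⟨h1, s, hs, h2⟩ := over_initEdges q ts u hu
    exact ⟨h1, s, by simp [subtrees, hs], h2⟩
theorem over_initEdges (p : α) : ∀ ts : List (OTree α),
    Over {x | ∃ l, x = node (Sum.inl l) []} {F | ∃ s ∈ subtreesList ts, F = initAux s}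
      (initEdges p ts)
  | [] => over_nil
  | t :: ts => by
    rw [initEdges, over_cons]
    constructor
    · intro u hu
      obtain ⟨h1, s, hs, h2⟩ := over_initEdge p t u hu
      exact ⟨h1, s, by simp [subtreesList, hs], h2⟩
    · intro u hu
      obtain ⟨h1, s, hs, h2⟩ := over_initEdges p ts u hu
      exact ⟨h1, s, by simp [subtreesList, hs], h2⟩
end

theorem over_initAux (T : OTree α) :
    Over {x | ∃ l, x = node (Sum.inl l) []} {F | ∃ s ∈ T.subtrees, F = initAux s} (initAux T) := by
  obtain ⟨a, ts⟩ := T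
  intro u hu
  obtain ⟨h1, s, hs, h2⟩ := over_initEdges a ts u hu
  exact ⟨h1, s, by simp [subtrees, hs], h2⟩

/-- The clusters on the edges of an auxiliary tree. -/
def clusters (F : AuxTree (Cluster α)) : Set (Cluster α) := {x | ∃ t ∈ subtreesList F, t.label = x}

theorem over_clusters (F : AuxTree (Cluster α)) : Over (clusters F) Set.univ F :=
  fun t ht => ⟨⟨t, ht, rfl⟩, trivial⟩

theorem clusters_iteration (F : AuxTree (Cluster α)) :
    clusters (iteration F) ⊆ clusters F ∪ merged (clusters F) := by
  rintro _ ⟨t, ht, rfl⟩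
  exact ((over_clusters F).iteration t ht).1

theorem self_mem_subtrees {β : Type u} (t : OTree β) : t ∈ t.subtrees := by
  obtain ⟨a, ts⟩ := t
  simp [subtrees]

/-- After `n` iterations, the auxiliary trees below its vertices are those of subtrees of `T`
after `n` iterations. -/
theorem over_iterate (T : OTree α) (n : ℕ) :
    Over Set.univ {F | ∃ s ∈ T.subtrees, F = iteration^[n] (initAux s)}
      (iteration^[n] (initAux T)) := by
  induction n with
  | zero => exact fun t ht => ⟨trivial, (over_initAux T t ht).2⟩
  | succ n ih =>
    intro t ht
    rw [Function.iterate_succ_apply'] at ht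
    obtain ⟨-, F, ⟨s, hs, rfl⟩, h⟩ := ih.iteration t ht
    exact ⟨trivial, s, hs, by rw [Function.iterate_succ_apply', h]⟩

/-- Every cluster present after `n` iterations leaves the root of the auxiliary tree which some
subtree of `T` has after `n` iterations. -/
theorem clusters_iterate (T : OTree α) (n : ℕ) (x : Cluster α)
    (hx : x ∈ clusters (iteration^[n] (initAux T))) :
    ∃ s ∈ T.subtrees, ∃ t ∈ iteration^[n] (initAux s), t.label = x := by
  obtain ⟨t, ht, rfl⟩ := hx
  refine (over_of_roots (L := {x | ∃ s ∈ T.subtrees, ∃ t ∈ iteration^[n] (initAux s), t.label = x})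
    ?_ _ (over_iterate T n) ?_ t ht).1
  · rintro F ⟨s, hs, rfl⟩ t ht
    exact ⟨s, hs, t, ht, rfl⟩
  · exact fun t ht => ⟨T, self_mem_subtrees T, t, ht, rfl⟩

/-- Every cluster inside a cluster of the `n`-th iterate is on an edge of an earlier iterate, and
has at most two children. -/
theorem subtrees_of_mem_clusters (T : OTree α) (n : ℕ) :
    ∀ x ∈ clusters (iteration^[n] (initAux T)), ∀ s ∈ x.subtrees,
      (∃ i ≤ n, s ∈ clusters (iteration^[i] (initAux T))) ∧ s.children.length ≤ 2 := by
  induction n with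
  | zero =>
    rintro _ ⟨t, ht, rfl⟩ s hs
    obtain ⟨l, hl⟩ := (over_initAux T t ht).1
    simp only [hl, subtrees, subtreesList, List.mem_singleton] at hs
    subst hs
    exact ⟨⟨0, le_rfl, t, ht, hl⟩, by simp [children]⟩
  | succ n ih =>
    intro x hx s hs
    have old : ∀ x ∈ clusters (iteration^[n] (initAux T)), ∀ s ∈ x.subtrees,
        (∃ i ≤ n + 1, s ∈ clusters (iteration^[i] (initAux T))) ∧ s.children.length ≤ 2 := by
      intro x hx s hs
      obtain ⟨⟨i, hi, h⟩, h'⟩ := ih x hx s hs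
      exact ⟨⟨i, by omega, h⟩, h'⟩
    have hx' := hx
    rw [Function.iterate_succ_apply'] at hx
    rcases clusters_iteration _ hx with h | ⟨m, y, hy, z, hz, rfl⟩
    · exact old x h s hs
    · simp only [subtrees, subtreesList, List.append_nil, List.mem_cons, List.mem_append] at hs
      rcases hs with rfl | hs | hs
      · exact ⟨⟨n + 1, le_rfl, hx'⟩, by simp [children]⟩
      · exact old y hy s hs
      · exact old z hz s hs

/-! ### Bounding the top DAG by the number of clusters per iteration -/

/-- The top DAG is small if few iterations suffice and few distinct clusters are present after
each of them. -/
theorem topDagSize_le (T : OTree α) (N B : ℕ) (hN : (edgeCount (initAux T) : ℝ) ≤ (6 / 5) ^ N)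
    (hB : ∀ i, ∃ S : Finset (Cluster α), S.card ≤ B ∧
      clusters (iteration^[i] (initAux T)) ⊆ S) :
    topDagSize T ≤ 3 * ((N + 1) * B) := by
  classical
  unfold topDagSize
  split
  case h_2 => exact Nat.zero_le _
  rename_i t ht
  have h0 : initAux T ≠ [] := by
    intro h
    have : ∀ n, iteration^[n] ([] : AuxTree (Cluster α)) = [] := fun n =>
      Function.iterate_fixed rfl n
    rw [topTree, h, this, onlyCluster] at ht
    · simp at ht
    · simp
  obtain ⟨x, hx⟩ := exists_iterate_eq_single_of_le_pow N _ h0 hN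
  -- Both this number of iterations and that in `topTree` end in the same single edge.
  have hxt : x = t := by
    unfold topTree onlyCluster at ht
    split at ht
    · rename_i y hy
      have h1 : iteration^[N + T.subtrees.length] (initAux T) = [node y []] := by
        rw [Function.iterate_add_apply, hy]
        exact Function.iterate_fixed (iteration_single y) N
      have h2 : iteration^[T.subtrees.length + N] (initAux T) = [node x []] := by
        rw [Function.iterate_add_apply, hx]
        exact Function.iterate_fixed (iteration_single x) _
      rw [add_comm, h2] at h1
      simp only [List.cons.injEq, node.injEq, and_true] at h1
      simpa [h1] using ht
    · simp at ht
  subst hxt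
  have hsub := subtrees_of_mem_clusters T N x ⟨node x [], by
    rw [hx]; simp [subtreesList, subtrees], rfl⟩
  choose S hS1 hS2 using hB
  have hV : x.dagVertices.card ≤ (N + 1) * B := by
    calc x.dagVertices.card ≤ ((Finset.range (N + 1)).biUnion S).card := by
          refine Finset.card_le_card fun s hs => ?_
          obtain ⟨⟨i, hi, h⟩, -⟩ := hsub s (by simpa [dagVertices] using hs)
          exact Finset.mem_biUnion.2 ⟨i, by simp; omega, hS2 i h⟩
      _ ≤ (Finset.range (N + 1)).card * B := Finset.card_biUnion_le_card_mul _ _ _ fun i _ => hS1 i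
      _ = (N + 1) * B := by rw [Finset.card_range]
  have hE : x.dagEdges.card ≤ x.dagVertices.card * 2 := by
    rw [dagEdges, Finset.card_sigma]
    refine Finset.sum_le_card_nsmul _ _ _ fun s hs => ?_
    rw [Finset.card_range]
    exact (hsub s (by simpa [dagVertices] using hs)).2
  rw [dagSize]
  omega

theorem three_le_treeSize {T : OTree α} (hT : T.children ≠ []) : 3 ≤ treeSize T := by
  obtain ⟨a, ts⟩ := T
  cases ts with
  | nil => simp [children] at hT
  | cons t ts =>
    obtain ⟨b, us⟩ := t
    simp [treeSize, subtrees, subtreesList, children]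
    omega

theorem edgeCount_initAux_le (T : OTree α) : edgeCount (initAux T) ≤ treeSize T := by
  obtain ⟨a, ts⟩ := T
  simp only [initAux, children, label, edgeCount_initEdges, treeSize, subtrees, List.length_cons]
  omega

/-- If at most `B` distinct clusters are present after each iteration, then the top DAG has size
`O(B * log n_T)`. -/
theorem topDagSize_le_log (T : OTree α) (B : ℕ)
    (hB : ∀ i, ∃ S : Finset (Cluster α), S.card ≤ B ∧
      clusters (iteration^[i] (initAux T)) ⊆ S) :
    (topDagSize T : ℝ) ≤ 24 * Real.log (treeSize T) * B := by
  by_cases hT : T.children = []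
  · have h0 : topDagSize T ≤ 3 * ((0 + 1) * 0) := by
      refine topDagSize_le T 0 0 ?_ fun i => ⟨∅, le_rfl, ?_⟩
      · simp [initAux, hT, initEdges, edgeCount_nil]
      · rintro x ⟨t, ht, -⟩
        have : iteration^[i] (initAux T) = [] := by
          rw [initAux, hT]
          exact Function.iterate_fixed rfl i
        simp [this, subtreesList] at ht
    have h1 : topDagSize T = 0 := by omega
    rw [h1]
    have := Real.log_natCast_nonneg (treeSize T)
    push_cast
    positivity
  have h3 : (3 : ℝ) ≤ treeSize T := by exact_mod_cast three_le_treeSize hT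
  have hlog : 1 ≤ Real.log (treeSize T) := by
    rw [Real.le_log_iff_exp_le (by linarith)]
    linarith [Real.exp_one_lt_three]
  have h65 : (1 : ℝ) / 6 ≤ Real.log (6 / 5) := by
    have := Real.one_sub_inv_le_log_of_pos (x := 6 / 5) (by norm_num)
    norm_num at this ⊢
    linarith
  -- `6 * log n_T` iterations suffice as `log (6 / 5) ≥ 1 / 6`.
  set N := ⌈6 * Real.log (treeSize T)⌉₊ with hN
  have hN1 : 6 * Real.log (treeSize T) ≤ N := Nat.le_ceil _
  have hN2 : (N : ℝ) < 6 * Real.log (treeSize T) + 1 := Nat.ceil_lt_add_one (by linarith)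
  have h := topDagSize_le T N B (by
    calc (edgeCount (initAux T) : ℝ) ≤ treeSize T := by exact_mod_cast edgeCount_initAux_le T
      _ ≤ (6 / 5) ^ N := by
        rw [← Real.log_le_log_iff (by linarith) (by positivity), Real.log_pow]
        nlinarith) hB
  calc (topDagSize T : ℝ) ≤ 3 * ((N + 1) * B) := by exact_mod_cast h
    _ ≤ 3 * ((8 * Real.log (treeSize T)) * B) := by gcongr; linarith
    _ = _ := by ring

/-! ### Clusters per iteration for arbitrary trees -/

theorem length_mergeRow_le (R : AuxTree (Cluster α × Bool)) :
    (mergeRow R).length ≤ R.length := by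
  fun_induction mergeRow R <;> simp <;> omega

theorem length_iteration_le (F : AuxTree (Cluster α)) : (iteration F).length ≤ F.length := by
  have h := length_mergeRow_le (horizontalEdges F)
  rw [horizontalEdges_eq_map, List.length_map, ← horizontalEdges_eq_map] at h
  simpa [iteration, verticalStep, verticalEdges_eq_map, horizontalStep] using h

theorem length_initEdges (p : α) (ts : List (OTree α)) : (initEdges p ts).length = ts.length := by
  induction ts with
  | nil => rfl
  | cons t ts ih => simp [initEdges, ih]

theorem length_iterate_le (T : OTree α) (n : ℕ) :
    (iteration^[n] (initAux T)).length ≤ T.children.length := by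
  induction n with
  | zero => simp [initAux, length_initEdges]
  | succ n ih =>
    rw [Function.iterate_succ_apply']
    exact (length_iteration_le _).trans ih

/-- After each iteration, there are at most as many distinct clusters as the minimal DAG of `T`
has edges: the clusters with a given top boundary node `v` depend only on the subtree rooted
at `v`, and there are at most as many of them as `v` has children. -/
theorem exists_clusters_subset (T : OTree α) (n : ℕ) : ∃ S : Finset (Cluster α),
    S.card ≤ T.dagEdges.card ∧ clusters (iteration^[n] (initAux T)) ⊆ S := by
  classical
  refine ⟨T.dagVertices.biUnion fun s => ((iteration^[n] (initAux s)).map label).toFinset, ?_, ?_⟩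
  · rw [dagEdges, Finset.card_sigma]
    refine Finset.card_biUnion_le.trans (Finset.sum_le_sum fun s _ => ?_)
    rw [Finset.card_range]
    refine (List.toFinset_card_le _).trans ?_
    rw [List.length_map]
    exact length_iterate_le s n
  · intro x hx
    obtain ⟨s, hs, t, ht, rfl⟩ := clusters_iterate T n x hx
    simp only [Finset.coe_biUnion, Set.mem_iUnion, Finset.mem_coe, List.mem_toFinset, List.mem_map]
    exact ⟨s, by simpa [dagVertices] using hs, t, ht, rfl⟩

/-! ### The iterates of paths and caterpillars -/

/-- The caterpillar, as an auxiliary tree, whose spine edges carry the given data from the top to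
the bottom, each spine edge having `j` leaf edges carrying `y` to its left. -/
def comb {β : Type u} (j : ℕ) (y : β) : List β → AuxTree β
  | [] => []
  | w :: ws => List.replicate j (node y []) ++ [node w (comb j y ws)]

theorem initEdges_caterpillar (a : α) (k m : ℕ) : initEdges a (caterpillar a k m).children =
    comb k (node (Sum.inl (a, a)) []) (List.replicate m (node (Sum.inl (a, a)) [])) := by
  have h (l : ℕ) (ts : List (OTree α)) : initEdges a (List.replicate l (node a []) ++ ts) =
      List.replicate l (node (node (Sum.inl (a, a)) []) []) ++ initEdges a ts := by
    induction l with
    | zero => rfl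
    | succ l ih =>
      rw [List.replicate_succ, List.replicate_succ, List.cons_append, List.cons_append,
        initEdges, initEdge, initEdges, ih]
  induction m with
  | zero => rfl
  | succ m ih =>
    rw [caterpillar, children, h, List.replicate_succ, comb, ← ih]
    cases m <;> rfl

theorem initAux_caterpillar (a : α) (k m : ℕ) : initAux (caterpillar a k m) =
    comb k (node (Sum.inl (a, a)) []) (List.replicate m (node (Sum.inl (a, a)) [])) := by
  rw [← initEdges_caterpillar, initAux]
  cases m <;> rfl

/-- Step 1 pairs off the legs, and merges the spine edge with the last leg if their number is
odd. -/
theorem mergeRow_replicate (y : Cluster α) (r : OTree (Cluster α × Bool)) : ∀ j : ℕ,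
    mergeRow (List.replicate j (node (y, false) []) ++ [r]) =
      List.replicate (j / 2) (node (node (Sum.inr .e) [y, y], true) []) ++
        [if j % 2 = 1 then mergeSiblings (node (y, false) []) r else r]
  | 0 => rfl
  | 1 => by simp [mergeRow, isLeaf, children]
  | 2 => by simp [mergeRow, isLeaf, children, mergeSiblings, horizontalType]
  | j + 3 => by
    have ih := mergeRow_replicate y r (j + 1)
    have h1 : (j + 3) / 2 = (j + 1) / 2 + 1 := by omega
    have h2 : (j + 3) % 2 = (j + 1) % 2 := by omega
    rw [h1, h2, List.replicate_succ (n := (j + 1) / 2), List.cons_append, ← ih]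
    rw [show j + 3 = (j + 1) + 1 + 1 from rfl, List.replicate_succ, List.replicate_succ,
      List.cons_append, List.cons_append]
    rw [mergeRow]
    · simp [isLeaf, children, mergeSiblings, horizontalType]
    · intro z hz
      simp [List.replicate_succ] at hz

/-- The spine edge carrying `w` after Step 1; `isLast` tells whether it is the lowest one. -/
def spineMerge (j : ℕ) (y w : Cluster α) (isLast : Bool) : Cluster α × Bool :=
  if j % 2 = 1 then (node (Sum.inr (horizontalType true isLast)) [y, w], true) else (w, false)

/-- The spine after Step 1. -/
def spineMerges (j : ℕ) (y : Cluster α) : List (Cluster α) → List (Cluster α × Bool)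
  | [] => []
  | w :: ws => spineMerge j y w ws.isEmpty :: spineMerges j y ws

theorem spineMerges_append (j : ℕ) (y b : Cluster α) (ws : List (Cluster α)) :
    spineMerges j y (ws ++ [b]) =
      ws.map (fun w => spineMerge j y w false) ++ [spineMerge j y b true] := by
  induction ws with
  | nil => rfl
  | cons w ws ih =>
    have : (ws ++ [b]).isEmpty = false := by simp
    simp [spineMerges, ih, this]

theorem horizontalStep_comb (j : ℕ) (y : Cluster α) (ws : List (Cluster α)) :
    horizontalStep (comb j y ws) =
      comb (j / 2) (node (Sum.inr .e) [y, y], true) (spineMerges j y ws) := by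
  induction ws with
  | nil => rfl
  | cons w ws ih =>
    have h : horizontalEdges (comb j y (w :: ws)) =
        List.replicate j (node (y, false) []) ++ [node (w, false) (horizontalStep (comb j y ws))] := by
      rw [horizontalEdges_eq_map, comb]
      simp [horizontalEdge, horizontalEdges, mergeRow, horizontalStep]
    rw [horizontalStep, h, mergeRow_replicate, ih, spineMerges, comb, spineMerge]
    have he : (comb (j / 2) ((node (Sum.inr .e) [y, y] : Cluster α), true)
        (spineMerges j y ws)).isEmpty = ws.isEmpty := by
      cases ws <;> simp [comb, spineMerges]
    split
    · simp [mergeSiblings, he]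
    · rfl

theorem map_fst_map_pair {β : Type u} (c : Bool) (F : List β) :
    (F.map fun t => (t, c)).map Prod.fst = F := by
  rw [List.map_map]
  exact List.map_id F

/-- Nothing happens in Step 2 as long as there are legs or the spine edges have been merged. -/
theorem verticalEdges_comb (j : ℕ) (y : Cluster α × Bool) (ws : List (Cluster α × Bool))
    (h : j ≠ 0 ∨ ∀ w ∈ ws, w.2 = true) :
    verticalEdges (comb j y ws) = (comb j y.1 (ws.map Prod.fst)).map fun t => (t, false) := by
  induction ws with
  | nil => rfl
  | cons w ws ih =>
    have ih := ih (h.imp_right fun h w hw => h w (by simp [hw]))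
    have hs : w.2 = true ∨ isSingleUnmarked (comb j y ws) = false := by
      rcases h with h | h
      · right
        obtain ⟨j, rfl⟩ := Nat.exists_eq_succ_of_ne_zero h
        cases ws with
        | nil => rfl
        | cons v ws =>
          rw [comb, List.replicate_succ]
          cases j <;> simp [isSingleUnmarked, List.replicate_succ]
      · left
        exact h w (by simp)
    have hw : verticalEdge (node w (comb j y ws)) =
        (node w.1 (comb j y.1 (ws.map Prod.fst)), false) := by
      obtain ⟨w, m⟩ := w
      rw [verticalEdge, ih]
      rcases hs with rfl | hs
      · simp only [joinBelow, map_fst_map_pair]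
      · simp only [hs, joinBelow, map_fst_map_pair]
    have hy : verticalEdge (node y []) = (node y.1 [], false) := by
      obtain ⟨y, m⟩ := y
      simp [verticalEdge, verticalEdges, isSingleUnmarked, joinBelow]
    rw [verticalEdges_eq_map, comb, List.map_cons, comb]
    simp [hw, hy]

/-- The spine edges after Step 2, when there are no legs, and whether the topmost of them is the
result of a merge. -/
def pairUp : List (Cluster α) → List (Cluster α) × Bool
  | [] => ([], false)
  | w :: ws =>
    match pairUp ws with
    | (y :: ys, false) => (node (Sum.inr (if ys.isEmpty then .b else .a)) [w, y] :: ys, true)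
    | (ys, _) => (w :: ys, false)

theorem verticalEdges_path (y : Cluster α × Bool) (z : Cluster α) (ws : List (Cluster α)) :
    verticalEdges (comb 0 y (ws.map fun w => (w, false))) =
      (comb 0 z (pairUp ws).1).map fun t => (t, (pairUp ws).2) := by
  induction ws with
  | nil => rfl
  | cons w ws ih =>
    have hs : ws ≠ [] → isSingleUnmarked (comb 0 y (ws.map fun w => (w, false))) = true := by
      cases ws <;> simp [comb, isSingleUnmarked]
    have hn : (pairUp ws).1 ≠ [] → ws ≠ [] := by
      rintro h rfl
      exact h rfl
    have he (ys : List (Cluster α)) : (comb 0 z ys).isEmpty = ys.isEmpty := by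
      cases ys <;> simp [comb]
    simp only [List.map_cons, comb, List.replicate_zero, List.nil_append, verticalEdges,
      verticalEdge, ih, pairUp]
    rcases hp : pairUp ws with ⟨_ | ⟨v, vs⟩, _ | _⟩
    · simp [joinBelow, comb]
    · simp [joinBelow, comb]
    · rw [hs (hn (by simp [hp]))]
      simp [joinBelow, comb, he]
    · simp [joinBelow, comb]

theorem pairUp_cons_of_true {ws ys : List (Cluster α)} (w : Cluster α)
    (h : pairUp ws = (ys, true)) : pairUp (w :: ws) = (w :: ys, false) := by
  simp only [pairUp, h]

/-- A path with an even number of edges is paired off completely; only the lowest merge is of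
type `b`. -/
theorem pairUp_replicate (w b : Cluster α) (q : ℕ) :
    pairUp (List.replicate (2 * q + 1) w ++ [b]) =
      (List.replicate q (node (Sum.inr .a) [w, w]) ++ [node (Sum.inr .b) [w, b]], true) := by
  induction q with
  | zero => simp [pairUp]
  | succ q ih =>
    rw [show 2 * (q + 1) + 1 = 2 * q + 1 + 1 + 1 from by ring, List.replicate_succ,
      List.replicate_succ, List.cons_append, List.cons_append, pairUp, pairUp_cons_of_true w ih]
    simp [List.replicate_succ]

/-- The spines that occur: all edges carry the same cluster, except for the bottom edge, and
possibly the top edge. -/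
def IsSpine (ws : List (Cluster α)) : Prop :=
  ∃ (xs : List (Cluster α)) (n : ℕ) (w b : Cluster α), xs.length ≤ 1 ∧
    ws = xs ++ List.replicate n w ++ [b]

theorem IsSpine.spineMerges {ws : List (Cluster α)} (h : IsSpine ws) (j : ℕ) (y : Cluster α) :
    IsSpine ((spineMerges j y ws).map Prod.fst) := by
  obtain ⟨xs, n, w, b, hx, rfl⟩ := h
  rw [spineMerges_append]
  exact ⟨xs.map fun w => (spineMerge j y w false).1, n, (spineMerge j y w false).1,
    (spineMerge j y b true).1, by simpa using hx, by simp⟩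

theorem IsSpine.pairUp {ws : List (Cluster α)} (h : IsSpine ws) : IsSpine (pairUp ws).1 := by
  obtain ⟨xs, n, w, b, hx, rfl⟩ := h
  match xs, n, hx with
  | [], 0, _ => exact ⟨[], 0, w, b, by simp, by simp [TopTrees.pairUp]⟩
  | [x], 0, _ => exact ⟨[], 0, w, node (Sum.inr .b) [x, b], by simp, by simp [TopTrees.pairUp]⟩
  | [], n + 1, _ =>
    obtain ⟨q, rfl | rfl⟩ := Nat.even_or_odd' n
    · exact ⟨[], q, _, _, by simp, by rw [List.nil_append, pairUp_replicate]; rfl⟩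
    · refine ⟨[w], q, node (Sum.inr .a) [w, w], node (Sum.inr .b) [w, b], by simp, ?_⟩
      rw [List.nil_append, List.replicate_succ, List.cons_append,
        pairUp_cons_of_true w (pairUp_replicate w b q)]
      rfl
  | [x], n + 1, _ =>
    obtain ⟨q, rfl | rfl⟩ := Nat.even_or_odd' n
    · refine ⟨[x], q, node (Sum.inr .a) [w, w], node (Sum.inr .b) [w, b], by simp, ?_⟩
      rw [List.append_assoc, List.singleton_append,
        pairUp_cons_of_true x (pairUp_replicate w b q)]
      rfl
    · refine ⟨[node (Sum.inr .a) [x, w]], q, node (Sum.inr .a) [w, w], node (Sum.inr .b) [w, b],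
        by simp, ?_⟩
      rw [List.append_assoc, List.singleton_append, List.replicate_succ, List.cons_append,
        TopTrees.pairUp, pairUp_cons_of_true w (pairUp_replicate w b q)]
      simp

/-- An iteration keeps the shape of a caterpillar: Step 1 halves the number of legs, and when none
are left, Step 2 halves the length of the spine. -/
theorem exists_iteration_comb (j : ℕ) (y : Cluster α) (ws : List (Cluster α)) (h : IsSpine ws) :
    ∃ j' y' ws', IsSpine ws' ∧ iteration (comb j y ws) = comb j' y' ws' := by
  rw [iteration, horizontalStep_comb, verticalStep]
  by_cases hj : j = 0
  · subst hj
    have h1 : spineMerges 0 y ws = ws.map fun w => (w, false) := by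
      clear h
      induction ws with
      | nil => rfl
      | cons w ws ih => rw [spineMerges, ih]; rfl
    rw [h1, Nat.zero_div, verticalEdges_path _ y]
    exact ⟨0, y, _, h.pairUp, map_fst_map_pair _ _⟩
  · rw [verticalEdges_comb]
    · exact ⟨j / 2, _, _, h.spineMerges j y, map_fst_map_pair _ _⟩
    · by_cases hj1 : j = 1
      · subst hj1
        right
        clear h
        induction ws with
        | nil => simp [spineMerges]
        | cons w ws ih => simpa [spineMerges, spineMerge] using ih
      · left
        omega

theorem clusters_comb (j : ℕ) (y : Cluster α) (ws : List (Cluster α)) :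
    clusters (comb j y ws) ⊆ {x | x = y ∨ x ∈ ws} := by
  suffices h : Over {x | x = y ∨ x ∈ ws} Set.univ (comb j y ws) by
    rintro _ ⟨t, ht, rfl⟩
    exact (h t ht).1
  induction ws with
  | nil => exact over_nil
  | cons w ws ih =>
    rw [comb, over_append, over_cons_node]
    refine ⟨over_iff_forall_mem.2 fun t ht => ?_, ⟨by simp, trivial, fun t ht => ?_⟩, over_nil⟩
    · rw [List.eq_of_mem_replicate ht, over_cons_node]
      exact ⟨⟨by simp, trivial, over_nil⟩, over_nil⟩
    · exact ⟨(ih t ht).1.imp_right fun h => by simp [h], trivial⟩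

theorem exists_clusters_caterpillar_subset (a : α) (k m : ℕ) (hm : 1 ≤ m) (i : ℕ) :
    ∃ S : Finset (Cluster α), S.card ≤ 4 ∧
      clusters (iteration^[i] (initAux (caterpillar a k m))) ⊆ S := by
  classical
  have h : ∃ j y ws, IsSpine ws ∧ iteration^[i] (initAux (caterpillar a k m)) = comb j y ws := by
    induction i with
    | zero =>
      refine ⟨k, _, _, ?_, initAux_caterpillar a k m⟩
      obtain ⟨m, rfl⟩ := Nat.exists_eq_add_of_le' hm
      exact ⟨[], m, _, _, by simp, List.replicate_succ'⟩
    | succ i ih =>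
      obtain ⟨j, y, ws, hws, h⟩ := ih
      rw [Function.iterate_succ_apply', h]
      exact exists_iteration_comb j y ws hws
  obtain ⟨j, y, _, ⟨xs, n, w, b, hx, rfl⟩, h⟩ := h
  refine ⟨{y, w, b} ∪ xs.toFinset, ?_, ?_⟩
  · have h1 : ({y, w, b} : Finset (Cluster α)).card ≤ 3 := Finset.card_le_three
    have h2 := List.toFinset_card_le xs
    have h3 := Finset.card_union_le {y, w, b} xs.toFinset
    omega
  · rw [h]
    intro z hz
    have := clusters_comb _ _ _ hz
    simp only [Set.mem_ofPred_eq, List.mem_append, List.mem_replicate, List.mem_singleton] at this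
    simp
    tauto

/-! ### The minimal DAGs of paths and caterpillars -/

theorem path_eq_caterpillar (a : α) (m : ℕ) : path a m = caterpillar a 0 m := by
  induction m with
  | zero => rfl
  | succ m ih => rw [path, ih, caterpillar]; rfl

theorem subtreesList_append {β : Type u} (F G : List (OTree β)) :
    subtreesList (F ++ G) = subtreesList F ++ subtreesList G := by
  induction F with
  | nil => rfl
  | cons t F ih => rw [List.cons_append, subtreesList, ih, subtreesList, List.append_assoc]

theorem subtreesList_replicate_leaf (a : α) (k : ℕ) :
    subtreesList (List.replicate k (node a [])) = List.replicate k (node a []) := by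
  induction k with
  | zero => rfl
  | succ k ih => rw [List.replicate_succ, subtreesList, ih]; rfl

theorem subtrees_caterpillar (a : α) (k m : ℕ) : (caterpillar a k (m + 1)).subtrees =
    caterpillar a k (m + 1) :: (List.replicate k (node a []) ++ (caterpillar a k m).subtrees) := by
  rw [caterpillar, subtrees, subtreesList_append, subtreesList_replicate_leaf]
  simp [subtreesList]

theorem length_children_caterpillar (a : α) (k m : ℕ) :
    (caterpillar a k (m + 1)).children.length = k + 1 := by
  simp [caterpillar, children]

theorem treeSize_caterpillar (a : α) (k m : ℕ) :
    treeSize (caterpillar a k m) = 2 * (m * (k + 1)) + 1 := by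
  unfold treeSize
  induction m with
  | zero => simp [caterpillar, subtrees, subtreesList, children]
  | succ m ih =>
    rw [subtrees_caterpillar]
    simp only [List.length_cons, List.length_append, List.length_replicate, List.map_cons,
      List.map_append, List.map_replicate, List.sum_cons, List.sum_append,
      length_children_caterpillar]
    have : (List.replicate k (children (node a [])).length).sum = 0 := by simp [children]
    rw [this]
    linarith

theorem caterpillar_mem_subtrees (a : α) (k : ℕ) {i m : ℕ} (h : i ≤ m) :
    caterpillar a k i ∈ (caterpillar a k m).subtrees := by
  induction m with
  | zero => obtain rfl : i = 0 := by omega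
            exact self_mem_subtrees _
  | succ m ih =>
    rcases Nat.lt_or_ge m i with h' | h'
    · obtain rfl : i = m + 1 := by omega
      exact self_mem_subtrees _
    · rw [subtrees_caterpillar]
      simp [ih h']

theorem caterpillar_injective (a : α) (k : ℕ) : Function.Injective (caterpillar a k) := by
  intro i j h
  have := congrArg treeSize h
  rw [treeSize_caterpillar, treeSize_caterpillar] at this
  have h' : i * (k + 1) = j * (k + 1) := by omega
  exact Nat.eq_of_mul_eq_mul_right k.succ_pos h'

/-- The spine vertices of a caterpillar are roots of distinct subtrees, so that sharing removes no
more than the leaves. -/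
theorem treeSize_caterpillar_le (a : α) (k m : ℕ) :
    treeSize (caterpillar a k m) ≤ 2 * dagSize (caterpillar a k m) := by
  classical
  have hsub : (Finset.range (m + 1)).image (caterpillar a k) ⊆ (caterpillar a k m).dagVertices := by
    intro t ht
    obtain ⟨i, hi, rfl⟩ := Finset.mem_image.1 ht
    simpa [dagVertices] using caterpillar_mem_subtrees a k (Nat.lt_succ_iff.1 (Finset.mem_range.1 hi))
  have hV := Finset.card_le_card hsub
  rw [Finset.card_image_of_injective _ (caterpillar_injective a k), Finset.card_range] at hV
  have hE : m * (k + 1) ≤ (caterpillar a k m).dagEdges.card := by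
    rw [dagEdges, Finset.card_sigma]
    simp only [Finset.card_range]
    refine le_trans ?_ (Finset.sum_le_sum_of_subset hsub)
    rw [Finset.sum_image (caterpillar_injective a k).injOn, Finset.sum_range_succ']
    simp [length_children_caterpillar]
  rw [treeSize_caterpillar, dagSize]
  omega

/-- Part (ii), also for caterpillars without legs, which are the paths. The constant is
`1 / (2 * 24 * 4)`: a factor `2` from `treeSize_caterpillar_le`, and `24 * 4` from
`topDagSize_le_log` with four clusters per iteration. -/
theorem caterpillar_bound (a : α) (k m : ℕ) (hm : 1 ≤ m) :
    1 / 192 * ((treeSize (caterpillar a k m) : ℝ) / Real.log (treeSize (caterpillar a k m) : ℝ)) *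
      (topDagSize (caterpillar a k m) : ℝ) ≤ (dagSize (caterpillar a k m) : ℝ) := by
  have h1 := topDagSize_le_log (caterpillar a k m) 4 (exists_clusters_caterpillar_subset a k m hm)
  have h2 : (treeSize (caterpillar a k m) : ℝ) ≤ 2 * dagSize (caterpillar a k m) := by
    exact_mod_cast treeSize_caterpillar_le a k m
  have h3 : (3 : ℝ) ≤ treeSize (caterpillar a k m) := by
    obtain ⟨m, rfl⟩ := Nat.exists_eq_add_of_le' hm
    exact_mod_cast three_le_treeSize (by simp [caterpillar, children])
  have hlog : 0 < Real.log (treeSize (caterpillar a k m)) := Real.log_pos (by linarith)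
  calc _ ≤ 1 / 192 * ((treeSize (caterpillar a k m) : ℝ) /
        Real.log (treeSize (caterpillar a k m) : ℝ)) *
          (24 * Real.log (treeSize (caterpillar a k m)) * (4 : ℕ)) := by gcongr
    _ = treeSize (caterpillar a k m) / 2 := by field_simp; norm_num
    _ ≤ _ := by linarith

end TopTrees

theorem theorem2 :
    (∃ C : ℝ, 0 < C ∧ ∀ (α : Type u) (T : OTree α),
      (topDagSize T : ℝ) ≤ C * Real.log (treeSize T : ℝ) * (dagSize T : ℝ)) ∧
    (∃ c : ℝ, 0 < c ∧ ∀ (α : Type u) (a : α) (m : ℕ), 1 ≤ m →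
      (c * ((treeSize (path a m) : ℝ) / Real.log (treeSize (path a m) : ℝ)) *
          (topDagSize (path a m) : ℝ) ≤ (dagSize (path a m) : ℝ)) ∧
      ∀ k : ℕ, 1 ≤ k →
        c * ((treeSize (caterpillar a k m) : ℝ) / Real.log (treeSize (caterpillar a k m) : ℝ)) *
          (topDagSize (caterpillar a k m) : ℝ) ≤ (dagSize (caterpillar a k m) : ℝ)) := by
  refine ⟨⟨24, by norm_num, fun α T => ?_⟩, 1 / 192, by norm_num, fun α a m hm => ⟨?_, ?_⟩⟩
  · refine (topDagSize_le_log T T.dagEdges.card (exists_clusters_subset T)).trans ?_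
    have := Real.log_natCast_nonneg (treeSize T)
    gcongr
    exact Nat.le_add_left _ _
  · rw [path_eq_caterpillar]
    exact caterpillar_bound a 0 m hm
  · exact fun k _ => caterpillar_bound a k m hm
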